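/- **Setting.** Enterprises own clusters of nodes. A cluster $P$ with failure bound $f$ has $2f+1$ ordering nodes if it is crash-only and $3f+1$ ordering nodes if it is Byzantine, of which at most $f$ are faulty; it may have further (execution) nodes. Faulty nodes of crash-only clusters follow the protocol until they stop; faulty nodes of Byzantine clusters are malicious and may send anything, but cannot forge the signatures of others. The *local-majority* of $P$ is $f+1$ (crash-only) resp. $2f+1$ (Byzantine) ordering nodes. A threshold signature of $P$ can be generated exactly from the signature shares of a local-majority of $P$. The network is asynchronous and may delay, drop or duplicate messages. A data collection $d_X$ is shared by a finite set $X$ of enterprises and divided into shards; each $e\in X$ maintains each shard of $d_X$ on one cluster, and different shards on different clusters. A request $m$ is executed on a nonempty set of shards of one collection $d_X$; its *involved clusters* are those that maintain these shards. An ID is $\langle\alpha,\gamma\rangle$ with local part $\alpha=[X{:}n]$ and global part $\gamma$, a partial map $Y\mapsto \gamma(Y)\in\mathbb N$ on collections with $X\subseteq Y$. Two IDs for different requests on $d_X$ are *consistent* if, in one of the two orders, $n<n'$ and $\gamma(Y)\le\gamma'(Y)$ whenever both are defined. $D$ is the digest function. **Protocols.** Each cluster runs an internal consensus protocol (e.g.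 Paxos or PBFT) that delivers decisions to its ordering nodes. A node that follows the protocol signs an order decided by its cluster only if the ID is consistent with all orders it has validated for other enterprises, and validates an order only if the ID is consistent with all orders it has validated or signed. * *Prepare.* One involved cluster $P_c$ (of the initiator enterprise) is the coordinator. When its internal consensus has ordered the client request $m$ with $\mathrm{ID}_c$, its nodes sign, and $P_c$ sends, $\langle \mathrm{PREPARE},\mathrm{ID}_c,D(m),m\rangle_{\sigma_{P_c}}$. * *Prepared.* Each other involved cluster $P_i$ of the initiator enterprise orders $m$ with some $\mathrm{ID}_i$ by internal consensus and sends $\langle \mathrm{PREPARED},\mathrm{ID}_c,\mathrm{ID}_i,D(m)\rangle_{\sigma_{P_i}}$. Each ordering node of an involved cluster of another enterprise validates the order suggested by the initiator's cluster for the same shard (by the PREPARE message if that cluster is $P_c$, by the PREPARED message otherwise) and sends its own signed PREPARED message with that ID. * *Commit.* A node of $P_c$ signs $\langle \mathrm{COMMIT},\mathrm{ID}_c,\mathrm{ID}_i,\mathrm{ID}_j,\dots,D(m)\rangle$ when $P_c$'s internal consensus has decided so and matching PREPARED messages have arrived from every other involved cluster: with the cluster's threshold signature for clusters of the initiator enterprise,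 from a local-majority of nodes for clusters of other enterprises. A node of an involved cluster *commits* $m$ with these IDs when it receives such a message with the threshold signature of $P_c$ (accompanied by the PREPARED messages if $m$ is on one shard of a collection shared by several enterprises). * A request on one shard of a collection of a single enterprise is ordered by the internal consensus of its only involved cluster and is committed on receipt of a commit certificate signed by a local-majority of that cluster. The local ID of a committed request $m$ in an involved cluster $P$ is the local part of the ID of $m$ for the shard maintained by $P$. **Proposition (Agreement).** Consider a finite execution of these protocols in which at most $f$ ordering nodes of each cluster are faulty, the internal consensus protocols are safe (two non-malicious nodes of a cluster never decide differently in the same consensus instance, i.e. for the same phase and the same local ID), and no two different requests that occur in the execution have the same digest. If a node $r$ commits request $m$ with local ID $\alpha$ in cluster $P$, then no non-faulty node $r'$ commits a request $m'\neq m$ with the same local ID $\alpha$ in $P$. -/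

import Mathlib

namespace Qanaat

universe u

/-- Failure model of a cluster. -/
inductive FailureModel where
  | crash
  | byzantine

/-- Number of ordering nodes of a cluster that tolerates `f` failures. -/
def FailureModel.size : FailureModel → ℕ → ℕ
  | .crash, f => 2 * f + 1
  | .byzantine, f => 3 * f + 1

/-- Local-majority: the number of matching votes that is required from a cluster. -/
def FailureModel.localMajority : FailureModel → ℕ → ℕ
  | .crash, f => f + 1
  | .byzantine, f => 2 * f + 1

/-- The static description of a deployment.  A data collection `d_X` is identified with the set
`X` of the enterprises that share it. -/
structure System where
  Enterprise : Type u
  Shard : Type u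
  Cluster : Type u
  Node : Type u
  Request : Type u
  Digest : Type u
  /-- the enterprise that owns a cluster -/
  owner : Cluster → Enterprise
  /-- the shards into which the data collection `d_X` is partitioned (one schema for all the
  enterprises in `X`) -/
  shardsOf : Finset Enterprise → Finset Shard
  /-- `place X s e` is the cluster of enterprise `e ∈ X` that maintains shard `s` of `d_X` -/
  place : Finset Enterprise → Shard → Enterprise → Cluster
  owner_place : ∀ X, ∀ s ∈ shardsOf X, ∀ e ∈ X, owner (place X s e) = e
  /-- different shards of a collection are maintained by different clusters of an enterprise -/
  place_injOn : ∀ X, ∀ e ∈ X, Set.InjOn (fun s => place X s e) (shardsOf X)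
  /-- the cluster a node belongs to -/
  clusterOf : Node → Cluster
  /-- the ordering nodes of a cluster; a cluster may have further (execution) nodes -/
  ordering : Cluster → Finset Node
  clusterOf_ordering : ∀ P, ∀ r ∈ ordering P, clusterOf r = P
  failureModel : Cluster → FailureModel
  /-- the number of failures of ordering nodes that a cluster tolerates -/
  f : Cluster → ℕ
  card_ordering : ∀ P, (ordering P).card = (failureModel P).size (f P)
  /-- the data collection a request is executed on -/
  coll : Request → Finset Enterprise
  coll_nonempty : ∀ m, (coll m).Nonempty
  /-- the shards of that collection on which a request is executed -/
  shards : Request → Finset Shard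
  shards_nonempty : ∀ m, (shards m).Nonempty
  shards_subset : ∀ m, shards m ⊆ shardsOf (coll m)
  /-- the hash function `D(·)` -/
  digest : Request → Digest

variable (C : System.{u})

/-- The local part `α = [X : n]` of an `ID`. -/
structure LocalID where
  coll : Finset C.Enterprise
  seq : ℕ

/-- An `ID = ⟨α, γ⟩`; `γ` partially maps data collections `d_Y` to sequence numbers. -/
structure TxID where
  loc : LocalID C
  glob : Finset C.Enterprise → Option ℕ

/-- The concatenation of the `ID`s of a request, one for each of its shards. -/
abbrev IDVec : Type u := C.Shard → Option (TxID C)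

variable {C}

/-- A transaction with `ID` `i` may be ordered before one with `ID` `j` on the same data
collection: local consistency and global consistency. -/
def TxID.Precedes (i j : TxID C) : Prop :=
  i.loc.seq < j.loc.seq ∧ ∀ Y a b, i.glob Y = some a → j.glob Y = some b → a ≤ b

/-- Two ordered transactions (given by `ID` and digest) obey the consistency rules: different
transactions on the same data collection are ordered in one of the two ways. -/
def Compatible (i : TxID C) (d : C.Digest) (j : TxID C) (d' : C.Digest) : Prop :=
  i.loc.coll = j.loc.coll → d ≠ d' → i.Precedes j ∨ j.Precedes i

/-- `i` is an `ID` of a transaction on the data collection of `m`, and its global part mentions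
only collections on which that one is order-dependent. -/
def TxID.FitsRequest (i : TxID C) (m : C.Request) : Prop :=
  i.loc.coll = C.coll m ∧ ∀ Y, i.glob Y ≠ none → C.coll m ⊆ Y

variable (C)

/-- Contents of the messages. -/
inductive Body where
  /-- `⟨PREPARE, ID_c, d, m⟩` -/
  | prepare (idc : TxID C) (d : C.Digest) (m : C.Request)
  /-- `⟨PREPARED, ID_c, ID_i, d⟩` (with `ID_i = ID_c` on the shard of the coordinator) -/
  | prepared (idc idi : TxID C) (d : C.Digest)
  /-- `⟨COMMIT, ID_c, ID_i, ID_j, ..., d⟩` -/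
  | commit (ids : IDVec C) (d : C.Digest)
  /-- commit certificate of a request that involves a single cluster -/
  | localCommit (id : TxID C) (d : C.Digest)

/-- Messages: a client request, a message signed by a node, a node's share of a threshold
signature, and a message that carries the threshold signature of a cluster. -/
inductive Msg where
  | client (m : C.Request)
  | signed (r : C.Node) (b : Body C)
  | share (r : C.Node) (b : Body C)
  | threshold (P : C.Cluster) (b : Body C)

/-- What the internal consensus protocol of a cluster delivers to a node of the cluster: the
order of a request in the cluster, or the agreement of the coordinator cluster to commit the
request that it has ordered with `idc`. -/
inductive Decision where
  | order (id : TxID C) (m : C.Request)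
  | commit (idc : TxID C) (ids : IDVec C) (m : C.Request)

variable {C}

/-- The consensus instance a decision belongs to: the phase (`true` for commit) and the local
`ID`, which is the slot that is being decided. -/
def Decision.inst : Decision C → Bool × LocalID C
  | .order id _ => (false, id.loc)
  | .commit idc _ _ => (true, idc.loc)

variable (C)

/-- Global state of an execution.  `net` holds every message sent so far; the network is
asynchronous and unreliable, so that a message may be received at any later time, any number of
times, or never. -/
structure State where
  net : Set (Msg C)
  /-- outputs of the internal consensus protocols at the nodes -/
  decided : Set (C.Node × Decision C)
  /-- ledger entries: the node, the request, and the `ID`s it was committed with -/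
  committed : Set (C.Node × C.Request × IDVec C)
  crashed : Set C.Node

/-- The initial state. -/
def State.init : State C := ⟨∅, ∅, ∅, ∅⟩

variable {C}

/-- Send a message. -/
def State.send (σ : State C) (μ : Msg C) : State C := { σ with net := insert μ σ.net }

/-- `m` has been sent to somebody, by a client or as part of a `PREPARE` message. -/
def Known (σ : State C) (m : C.Request) : Prop :=
  Msg.client m ∈ σ.net ∨ ∃ idc d,
    (∃ r, Msg.signed r (.prepare idc d m) ∈ σ.net) ∨
    (∃ r, Msg.share r (.prepare idc d m) ∈ σ.net) ∨
    (∃ P, Msg.threshold P (.prepare idc d m) ∈ σ.net)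

/-- A local-majority of the ordering nodes of cluster `P` satisfies `S`. -/
def LocalMajority (P : C.Cluster) (S : C.Node → Prop) : Prop :=
  ∃ Q ⊆ C.ordering P, (C.failureModel P).localMajority (C.f P) ≤ Q.card ∧ ∀ r ∈ Q, S r

/-- The cluster `P` maintains, for enterprise `e`, the shard `s` that `m` is executed on. -/
def InvolvedAt (m : C.Request) (P : C.Cluster) (s : C.Shard) (e : C.Enterprise) : Prop :=
  s ∈ C.shards m ∧ e ∈ C.coll m ∧ P = C.place (C.coll m) s e

/-- `P` is one of the clusters involved in `m`. -/
def Involved (m : C.Request) (P : C.Cluster) : Prop := ∃ s e, InvolvedAt m P s e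

/-- A request on one shard of the data collection of one enterprise. -/
def IntraCluster (m : C.Request) : Prop := (C.shards m).card = 1 ∧ (C.coll m).card = 1

/-- Node `r` has validated the order `id`, suggested by another enterprise, of the request with
digest `d`, i.e., has sent a signed `PREPARED` message. -/
def Validated (σ : State C) (r : C.Node) (id : TxID C) (d : C.Digest) : Prop :=
  ∃ idc, Msg.signed r (.prepared idc id d) ∈ σ.net

/-- Node `r` has signed the order `id` of the request with digest `d` on behalf of its cluster. -/
def Ordered (σ : State C) (r : C.Node) (id : TxID C) (d : C.Digest) : Prop :=
  (∃ m, Msg.share r (.prepare id d m) ∈ σ.net) ∨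
  (∃ idc, Msg.share r (.prepared idc id d) ∈ σ.net) ∨
  Msg.share r (.localCommit id d) ∈ σ.net

/-- `id` obeys the consistency rules with respect to the orders that `r` has validated. -/
def CompatValidated (σ : State C) (r : C.Node) (id : TxID C) (d : C.Digest) : Prop :=
  ∀ id' d', Validated σ r id' d' → Compatible id' d' id d

/-- `id` obeys the consistency rules with respect to all the orders that `r` has agreed with. -/
def CompatAll (σ : State C) (r : C.Node) (id : TxID C) (d : C.Digest) : Prop :=
  ∀ id' d', Validated σ r id' d' ∨ Ordered σ r id' d' → Compatible id' d' id d

/-- `PREPARED` messages from every involved cluster for the request `m`, with digest `d`, that is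
coordinated by the cluster of enterprise `e₀` that maintains shard `s₀`: a message with the
threshold signature of each other involved cluster of `e₀`, and messages signed by a
local-majority of each involved cluster of the other enterprises.  All the clusters that maintain
the same shard `s` use the same `ID`, which is `ids s`. -/
def PreparedByAll (σ : State C) (m : C.Request) (d : C.Digest) (s₀ : C.Shard)
    (e₀ : C.Enterprise) (idc : TxID C) (ids : IDVec C) : Prop :=
  ids s₀ = some idc ∧
  ∀ s ∈ C.shards m, ∃ id, ids s = some id ∧
    (s ≠ s₀ → Msg.threshold (C.place (C.coll m) s e₀) (.prepared idc id d) ∈ σ.net) ∧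
    ∀ e ∈ C.coll m, e ≠ e₀ →
      LocalMajority (C.place (C.coll m) s e)
        (fun r => Msg.signed r (.prepared idc id d) ∈ σ.net)

/-- The steps that the coordinator-based protocols allow node `r`.  One set of rules covers the
intra-shard cross-enterprise, cross-shard intra-enterprise and cross-shard cross-enterprise
protocols, as well as requests that involve one cluster only.

The primary of a cluster chooses what to propose to the internal consensus, and it assembles and
multicasts the messages with threshold signatures.  Here the former is left open and the latter is
open to every node, so that every sequence of primaries and every order of proposals is covered;
`ABORT` and query messages enable no step below and are left out. -/
inductive NodeStep (σ : State C) (r : C.Node) : State C → Prop where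
  /-- The internal consensus of its cluster delivers a decision to ordering node `r`. -/
  | decide (dec : Decision C) (hr : r ∈ C.ordering (C.clusterOf r)) :
      NodeStep σ r { σ with decided := insert (r, dec) σ.decided }
  /-- A threshold signature of cluster `P` is generated from the shares of a local-majority. -/
  | combine (P : C.Cluster) (b : Body C)
      (h : LocalMajority P (fun q => Msg.share q b ∈ σ.net)) :
      NodeStep σ r (σ.send (.threshold P b))
  /-- Prepare: the coordinator cluster has ordered the client request `m`. -/
  | prepare (m : C.Request) (idc : TxID C)
      (hr : r ∈ C.ordering (C.clusterOf r))
      (hinv : Involved m (C.clusterOf r)) (hcross : ¬ IntraCluster m)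
      (hreq : Msg.client m ∈ σ.net)
      (hdec : (r, Decision.order idc m) ∈ σ.decided)
      (hfit : idc.FitsRequest m) (hcons : CompatValidated σ r idc (C.digest m)) :
      NodeStep σ r (σ.send (.share r (.prepare idc (C.digest m) m)))
  /-- Prepared, in another involved cluster of the initiator enterprise: the cluster has
  received a `PREPARE` message of the coordinator cluster `Pc` and has ordered the request. -/
  | preparedInitiator (m : C.Request) (Pc : C.Cluster) (s₀ s : C.Shard) (e₀ : C.Enterprise)
      (idc idi : TxID C)
      (hr : r ∈ C.ordering (C.clusterOf r))
      (hc : InvolvedAt m Pc s₀ e₀) (hinv : InvolvedAt m (C.clusterOf r) s e₀) (hs : s ≠ s₀)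
      (hmsg : Msg.threshold Pc (.prepare idc (C.digest m) m) ∈ σ.net)
      (hdec : (r, Decision.order idi m) ∈ σ.decided)
      (hfit : idi.FitsRequest m) (hcons : CompatValidated σ r idi (C.digest m)) :
      NodeStep σ r (σ.send (.share r (.prepared idc idi (C.digest m))))
  /-- Prepared, in a cluster of another enterprise that maintains the same shard as the
  coordinator cluster `Pc`: the node validates the order suggested by `Pc`. -/
  | validateCoordinator (m : C.Request) (Pc : C.Cluster) (s₀ : C.Shard) (e₀ e : C.Enterprise)
      (idc : TxID C)
      (hr : r ∈ C.ordering (C.clusterOf r))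
      (hc : InvolvedAt m Pc s₀ e₀) (hinv : InvolvedAt m (C.clusterOf r) s₀ e) (he : e ≠ e₀)
      (hmsg : Msg.threshold Pc (.prepare idc (C.digest m) m) ∈ σ.net)
      (hfit : idc.FitsRequest m) (hcons : CompatAll σ r idc (C.digest m)) :
      NodeStep σ r (σ.send (.signed r (.prepared idc idc (C.digest m))))
  /-- Prepared, in a cluster of another enterprise that maintains another shard: the node
  validates the order suggested by the cluster `Pi` of the initiator enterprise that maintains
  the same shard. -/
  | validateInvolved (m : C.Request) (Pi : C.Cluster) (s : C.Shard) (e₀ e : C.Enterprise)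
      (idc idi : TxID C)
      (hr : r ∈ C.ordering (C.clusterOf r))
      (hi : InvolvedAt m Pi s e₀) (hinv : InvolvedAt m (C.clusterOf r) s e) (he : e ≠ e₀)
      (hknown : Known σ m)
      (hmsg : Msg.threshold Pi (.prepared idc idi (C.digest m)) ∈ σ.net)
      (hfit : idi.FitsRequest m) (hcons : CompatAll σ r idi (C.digest m)) :
      NodeStep σ r (σ.send (.signed r (.prepared idc idi (C.digest m))))
  /-- Commit, in the coordinator cluster: the request is prepared by all involved clusters, and
  the internal consensus has decided to commit it. -/
  | signCommit (m : C.Request) (s₀ : C.Shard) (e₀ : C.Enterprise) (idc : TxID C) (ids : IDVec C)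
      (hr : r ∈ C.ordering (C.clusterOf r))
      (hc : InvolvedAt m (C.clusterOf r) s₀ e₀)
      (hmsg : Msg.threshold (C.clusterOf r) (.prepare idc (C.digest m) m) ∈ σ.net)
      (hprep : PreparedByAll σ m (C.digest m) s₀ e₀ idc ids)
      (hdec : (r, Decision.commit idc ids m) ∈ σ.decided) :
      NodeStep σ r (σ.send (.share r (.commit ids (C.digest m))))
  /-- A node (ordering or execution node) of an involved cluster receives a valid `COMMIT`
  message of the coordinator cluster `Pc` and appends the request to the ledger.  The message
  includes the `PREPARED` messages in the intra-shard cross-enterprise protocol only. -/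
  | commit (m : C.Request) (Pc : C.Cluster) (s₀ : C.Shard) (e₀ : C.Enterprise) (ids : IDVec C)
      (hinv : Involved m (C.clusterOf r)) (hcross : ¬ IntraCluster m)
      (hc : InvolvedAt m Pc s₀ e₀)
      (hknown : Known σ m)
      (hmsg : Msg.threshold Pc (.commit ids (C.digest m)) ∈ σ.net)
      (hevid : (C.shards m).card = 1 →
        ∃ idc, PreparedByAll σ m (C.digest m) s₀ e₀ idc ids) :
      NodeStep σ r { σ with committed := insert (r, m, ids) σ.committed }
  /-- Request on a single cluster: the internal consensus has ordered the request. -/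
  | signLocal (m : C.Request) (id : TxID C)
      (hr : r ∈ C.ordering (C.clusterOf r))
      (hinv : Involved m (C.clusterOf r)) (hintra : IntraCluster m)
      (hreq : Msg.client m ∈ σ.net)
      (hdec : (r, Decision.order id m) ∈ σ.decided)
      (hfit : id.FitsRequest m) (hcons : CompatValidated σ r id (C.digest m)) :
      NodeStep σ r (σ.send (.share r (.localCommit id (C.digest m))))
  /-- Request on a single cluster: a node of the cluster receives a valid commit certificate and
  appends the request to the ledger. -/
  | commitLocal (m : C.Request) (s : C.Shard) (id : TxID C) (ids : IDVec C)
      (hinv : Involved m (C.clusterOf r)) (hintra : IntraCluster m) (hs : s ∈ C.shards m)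
      (hknown : Known σ m)
      (hmsg : Msg.threshold (C.clusterOf r) (.localCommit id (C.digest m)) ∈ σ.net)
      (hids : ids s = some id) :
      NodeStep σ r { σ with committed := insert (r, m, ids) σ.committed }

/-- A faulty node of a Byzantine cluster.  (The faulty nodes of crash-only clusters follow the
protocol until they crash.) -/
def Malicious (faulty : Set C.Node) (r : C.Node) : Prop :=
  r ∈ faulty ∧ C.failureModel (C.clusterOf r) = .byzantine

/-- One step of the system.  Signatures cannot be forged: a malicious node can produce any
message and any signature share in its own name, but none in the name of another node. -/
inductive Step (faulty : Set C.Node) (σ : State C) : State C → Prop where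
  | client (m : C.Request) : Step faulty σ (σ.send (.client m))
  | node (r : C.Node) (σ' : State C) (hr : r ∉ σ.crashed) (h : NodeStep σ r σ') :
      Step faulty σ σ'
  | crash (r : C.Node) (hr : r ∈ faulty) :
      Step faulty σ { σ with crashed := insert r σ.crashed }
  | malSigned (r : C.Node) (b : Body C) (hr : Malicious faulty r) :
      Step faulty σ (σ.send (.signed r b))
  | malShare (r : C.Node) (b : Body C) (hr : Malicious faulty r) :
      Step faulty σ (σ.send (.share r b))

/-- `σ` is the state after some finite execution. -/
def Reachable (faulty : Set C.Node) (σ : State C) : Prop :=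
  Relation.ReflTransGen (Step faulty) (State.init C) σ

/-- At most `f` ordering nodes of each cluster are faulty. -/
def FaultBound (faulty : Set C.Node) : Prop :=
  ∀ P : C.Cluster, {r | r ∈ C.ordering P ∧ r ∈ faulty}.ncard ≤ C.f P

/-- Collision resistance: no two different requests with the same digest turned up. -/
def NoCollision (σ : State C) : Prop :=
  ∀ m m', Known σ m → Known σ m' → C.digest m = C.digest m' → m = m'

/-- Safety of the internal consensus protocols: no two different decisions are delivered in the
same consensus instance of a cluster by nodes that are not malicious. -/
def InternalConsensusSafe (faulty : Set C.Node) (σ : State C) : Prop :=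
  ∀ r r' dec dec', C.clusterOf r = C.clusterOf r' →
    ¬ Malicious faulty r → ¬ Malicious faulty r' →
    (r, dec) ∈ σ.decided → (r', dec') ∈ σ.decided → dec.inst = dec'.inst → dec = dec'

/-- Node `r` has committed request `m`, and the local `ID` of `m` in the involved cluster `P`
is `α`. -/
def Commits (σ : State C) (r : C.Node) (m : C.Request) (α : LocalID C) (P : C.Cluster) : Prop :=
  ∃ ids s e id, (r, m, ids) ∈ σ.committed ∧ InvolvedAt m P s e ∧ ids s = some id ∧ id.loc = α

end Qanaat

namespace Qanaat

universe u

variable {C : System.{u}} {faulty : Set C.Node} {σ σ' : State C}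

/-! A certificate for a commit traces back to votes in every involved cluster `P`: some
local-majority of `P` has either signed the order of the request (`Ordered`, in clusters of the
initiator enterprise) or validated it (`Validated`, in clusters of other enterprises). This is
`Commits.known_and_localMajority`; it works because a threshold signature needs shares of a
local-majority, at least one from a node that is not malicious, and such a node signs only under the
guards of the protocol.

Suppose two different requests are committed in `P` with the same local ID. If both were ordered,
two nodes of `P` that are not malicious hold different decisions of one consensus instance, which
contradicts its safety. If at least one was validated, the two local-majorities share a node that is
not malicious. It agreed with two orders, one of them by validation, so they are compatible
(`Reachable.compatible_of_validated`); but compatible orders of different requests have different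
sequence numbers.

Honesty means "not malicious" throughout: a faulty node of a crash-only cluster still obeys the
protocol while it runs. Messages carry digests, so requests are identified through `NoCollision`,
which is why `Known` accompanies each invariant that yields a request. -/

theorem Compatible.symm {i j : TxID C} {d d' : C.Digest} (h : Compatible i d j d') :
    Compatible j d' i d :=
  fun hc hd => (h hc.symm hd.symm).symm

/-- Different transactions with the same local `ID` are not compatible. -/
theorem not_compatible_of_loc_eq {i j : TxID C} {d d' : C.Digest} (hloc : i.loc = j.loc)
    (hd : d ≠ d') : ¬ Compatible i d j d' := by
  intro h
  rcases h (by rw [hloc]) hd with h | h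
  · exact absurd h.1 (by rw [hloc]; exact lt_irrefl _)
  · exact absurd h.1 (by rw [hloc]; exact lt_irrefl _)

/-! ### Monotonicity -/

theorem Step.net_subset (h : Step faulty σ σ') : σ.net ⊆ σ'.net := by
  cases h with
  | node r _ _ h => cases h <;> first | exact subset_rfl | exact Set.subset_insert _ _
  | crash => exact subset_rfl
  | _ => exact Set.subset_insert _ _

theorem Step.decided_subset (h : Step faulty σ σ') : σ.decided ⊆ σ'.decided := by
  cases h with
  | node r _ _ h => cases h <;> first | exact subset_rfl | exact Set.subset_insert _ _
  | _ => exact subset_rfl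

theorem Known.mono {m : C.Request} (hs : σ.net ⊆ σ'.net) (h : Known σ m) : Known σ' m := by
  rcases h with h | ⟨idc, d, ⟨r, h⟩ | ⟨r, h⟩ | ⟨P, h⟩⟩
  · exact Or.inl (hs h)
  · exact Or.inr ⟨idc, d, Or.inl ⟨r, hs h⟩⟩
  · exact Or.inr ⟨idc, d, Or.inr (Or.inl ⟨r, hs h⟩)⟩
  · exact Or.inr ⟨idc, d, Or.inr (Or.inr ⟨P, hs h⟩)⟩

theorem LocalMajority.mono {P : C.Cluster} {S T : C.Node → Prop} (hST : ∀ r, S r → T r)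
    (h : LocalMajority P S) : LocalMajority P T := by
  obtain ⟨Q, hQ, hcard, hS⟩ := h
  exact ⟨Q, hQ, hcard, fun r hr => hST r (hS r hr)⟩

theorem PreparedByAll.mono {m : C.Request} {d : C.Digest} {s₀ : C.Shard} {e₀ : C.Enterprise}
    {idc : TxID C} {ids : IDVec C} (hs : σ.net ⊆ σ'.net)
    (h : PreparedByAll σ m d s₀ e₀ idc ids) : PreparedByAll σ' m d s₀ e₀ idc ids := by
  refine ⟨h.1, fun s hsm => ?_⟩
  obtain ⟨id, hid, hth, hmaj⟩ := h.2 s hsm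
  exact ⟨id, hid, fun hne => hs (hth hne),
    fun e he hne => (hmaj e he hne).mono fun _ hr => hs hr⟩

/-! ### Quorums -/

/-- A local-majority contains more nodes than the malicious ones. -/
theorem exists_not_malicious_of_localMajority (hfault : FaultBound faulty) {P : C.Cluster}
    {S : C.Node → Prop} (h : LocalMajority P S) :
    ∃ r ∈ C.ordering P, ¬ Malicious faulty r ∧ S r := by
  classical
  obtain ⟨Q, hQ, hcard, hS⟩ := h
  by_contra! hcon
  have hmal : ∀ r ∈ Q, Malicious faulty r := fun r hr => by
    by_contra hm
    exact hcon r (hQ hr) hm (hS r hr)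
  have hle : Q.card ≤ C.f P := by
    refine le_trans ?_ (hfault P)
    rw [← Set.ncard_coe_finset Q]
    exact Set.ncard_le_ncard (fun r hr => ⟨hQ hr, (hmal r hr).1⟩)
      ((C.ordering P).finite_toSet.subset fun r hr => hr.1)
  cases hm : C.failureModel P <;> rw [hm] at hcard <;>
    simp only [FailureModel.localMajority] at hcard <;> omega

/-- Two local-majorities of a cluster share a node that is not malicious. -/
theorem exists_not_malicious_of_two_localMajorities (hfault : FaultBound faulty)
    {P : C.Cluster} {S T : C.Node → Prop} (hS : LocalMajority P S) (hT : LocalMajority P T) :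
    ∃ r, ¬ Malicious faulty r ∧ S r ∧ T r := by
  classical
  obtain ⟨Q, hQ, hcQ, hSQ⟩ := hS
  obtain ⟨R, hR, hcR, hTR⟩ := hT
  have hunion : (Q ∪ R).card ≤ (C.ordering P).card :=
    Finset.card_le_card (Finset.union_subset hQ hR)
  have hsum := Finset.card_union_add_card_inter Q R
  have hcard := C.card_ordering P
  by_contra! hcon
  have hmal : ∀ r ∈ Q ∩ R, Malicious faulty r := fun r hr => by
    rw [Finset.mem_inter] at hr
    by_contra hm
    exact hcon r hm (hSQ r hr.1) (hTR r hr.2)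
  have hsub : ∀ r ∈ Q ∩ R, r ∈ C.ordering P := fun r hr => hQ (Finset.mem_inter.1 hr).1
  cases hm : C.failureModel P with
  | crash =>
    rw [hm] at hcQ hcR hcard
    simp only [FailureModel.localMajority, FailureModel.size] at hcQ hcR hcard
    -- Since 2(f+1) > 2f+1, the quorums meet, and one common node is enough: no node of a crash-only
    -- cluster is malicious.
    obtain ⟨r, hr⟩ : (Q ∩ R).Nonempty := Finset.card_pos.1 (by omega)
    have hbyz := (hmal r hr).2
    rw [C.clusterOf_ordering P r (hsub r hr), hm] at hbyz
    cases hbyz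
  | byzantine =>
    rw [hm] at hcQ hcR hcard
    simp only [FailureModel.localMajority, FailureModel.size] at hcQ hcR hcard
    -- The overlap has at least 2(2f+1) - (3f+1) = f+1 nodes, too many for all of them to be
    -- malicious.
    have hle : (Q ∩ R).card ≤ C.f P := by
      refine le_trans ?_ (hfault P)
      rw [← Set.ncard_coe_finset (Q ∩ R)]
      exact Set.ncard_le_ncard (fun r hr => ⟨hsub r hr, (hmal r hr).1⟩)
        ((C.ordering P).finite_toSet.subset fun r hr => hr.1)
    omega

/-! ### What a single step can add -/

theorem Step.threshold_new (h : Step faulty σ σ') {P : C.Cluster} {b : Body C}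
    (hmem : Msg.threshold P b ∈ σ'.net) :
    Msg.threshold P b ∈ σ.net ∨ LocalMajority P (fun q => Msg.share q b ∈ σ.net) := by
  cases h with
  | node r _ _ h =>
    cases h <;> simp_all [State.send]
    rcases hmem with ⟨rfl, rfl⟩ | hmem
    · exact Or.inr ‹_›
    · exact Or.inl hmem
  | _ => simp_all [State.send]

/-- The equation for `σ'` records that this one message is all that changed, so any other order the
node agrees with was already visible to the check `CompatAll`. -/
theorem Step.validated_new (h : Step faulty σ σ') {q : C.Node} (hq : ¬ Malicious faulty q)
    {id : TxID C} {d : C.Digest} (hv : Validated σ' q id d) :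
    Validated σ q id d ∨ (CompatAll σ q id d ∧
      ∃ idc, σ' = σ.send (.signed q (.prepared idc id d))) := by
  obtain ⟨idc, hmem⟩ := hv
  by_cases hold : Msg.signed q (.prepared idc id d) ∈ σ.net
  · exact Or.inl ⟨idc, hold⟩
  refine Or.inr ?_
  cases h with
  | node r _ _ h =>
    cases h <;> simp [State.send, hold] at hmem
    · obtain ⟨rfl, rfl, rfl, rfl⟩ := hmem
      exact ⟨‹_›, _, rfl⟩
    · obtain ⟨rfl, rfl, rfl, rfl⟩ := hmem
      exact ⟨‹_›, _, rfl⟩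
  | malSigned r b hr =>
    simp [State.send, hold] at hmem
    exact absurd (hmem.1 ▸ hr) hq
  | _ => simp [State.send, hold] at hmem

/-- The guard here is only `CompatValidated`: two orders signed by the same node are never compared
with each other, since internal consensus separates them. -/
theorem Step.ordered_new (h : Step faulty σ σ') {q : C.Node} (hq : ¬ Malicious faulty q)
    {id : TxID C} {d : C.Digest} (ho : Ordered σ' q id d) :
    Ordered σ q id d ∨
      ((∃ m, C.digest m = d ∧ Known σ m ∧ (q, Decision.order id m) ∈ σ.decided) ∧
        CompatValidated σ q id d ∧ ∃ b, σ' = σ.send (.share q b)) := by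
  by_cases hold : Ordered σ q id d
  · exact Or.inl hold
  refine Or.inr ?_
  simp only [Ordered, not_or, not_exists] at hold
  obtain ⟨h₁, h₂, h₃⟩ := hold
  cases h with
  | node r _ _ h =>
    cases h <;> simp [Ordered, State.send, h₁, h₂, h₃] at ho
    case prepare hreq hdec _ hcons =>
      obtain ⟨rfl, rfl, rfl⟩ := ho
      exact ⟨⟨_, rfl, Or.inl hreq, hdec⟩, hcons, _, rfl⟩
    -- The request is known because the PREPARE message of the coordinator carries it in full.
    case preparedInitiator hmsg hdec _ hcons =>
      obtain ⟨rfl, rfl, rfl⟩ := ho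
      exact ⟨⟨_, rfl, Or.inr ⟨_, _, Or.inr (Or.inr ⟨_, hmsg⟩)⟩, hdec⟩, hcons, _, rfl⟩
    case signLocal hreq hdec _ hcons =>
      obtain ⟨rfl, rfl, rfl⟩ := ho
      exact ⟨⟨_, rfl, Or.inl hreq, hdec⟩, hcons, _, rfl⟩
  | malShare r b hr =>
    -- A malicious node makes shares only in its own name.
    have hne : q ≠ r := fun hqr => hq (hqr ▸ hr)
    simp [Ordered, State.send, h₁, h₂, h₃, hne] at ho
  | _ => simp [Ordered, State.send, h₁, h₂, h₃] at ho

theorem Step.share_commit_new (h : Step faulty σ σ') {q : C.Node} (hq : ¬ Malicious faulty q)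
    {ids : IDVec C} {d : C.Digest} (hmem : Msg.share q (.commit ids d) ∈ σ'.net) :
    Msg.share q (.commit ids d) ∈ σ.net ∨
      ∃ m s₀ e₀ idc, C.digest m = d ∧ InvolvedAt m (C.clusterOf q) s₀ e₀ ∧
        Msg.threshold (C.clusterOf q) (.prepare idc d m) ∈ σ.net ∧
        PreparedByAll σ m d s₀ e₀ idc ids := by
  by_cases hold : Msg.share q (.commit ids d) ∈ σ.net
  · exact Or.inl hold
  refine Or.inr ?_
  cases h with
  | node r _ _ h =>
    cases h <;> simp [State.send, hold] at hmem
    obtain ⟨rfl, rfl, rfl⟩ := hmem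
    exact ⟨_, _, _, _, rfl, ‹_›, ‹_›, ‹_›⟩
  | malShare r b hr =>
    simp [State.send, hold] at hmem
    exact absurd (hmem.1 ▸ hr) hq
  | _ => simp [State.send, hold] at hmem

/-- The certificate on which `r` commits `m` with the `ID`s `ids`. -/
def CommitCertified (σ : State C) (r : C.Node) (m : C.Request) (ids : IDVec C) : Prop :=
  (∃ Pc s₀ e₀, InvolvedAt m Pc s₀ e₀ ∧ Msg.threshold Pc (.commit ids (C.digest m)) ∈ σ.net) ∨
  (IntraCluster m ∧ Involved m (C.clusterOf r) ∧ ∃ s ∈ C.shards m, ∃ id, ids s = some id ∧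
    Msg.threshold (C.clusterOf r) (.localCommit id (C.digest m)) ∈ σ.net)

theorem CommitCertified.mono {r : C.Node} {m : C.Request} {ids : IDVec C}
    (hs : σ.net ⊆ σ'.net) (h : CommitCertified σ r m ids) : CommitCertified σ' r m ids := by
  rcases h with ⟨Pc, s₀, e₀, hc, h⟩ | ⟨hi, hv, s, hsm, id, hid, h⟩
  · exact Or.inl ⟨Pc, s₀, e₀, hc, hs h⟩
  · exact Or.inr ⟨hi, hv, s, hsm, id, hid, hs h⟩

theorem Step.committed_new (h : Step faulty σ σ') {q : C.Node} {m : C.Request} {ids : IDVec C}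
    (hmem : (q, m, ids) ∈ σ'.committed) :
    (q, m, ids) ∈ σ.committed ∨ (Known σ m ∧ CommitCertified σ q m ids) := by
  by_cases hold : (q, m, ids) ∈ σ.committed
  · exact Or.inl hold
  refine Or.inr ?_
  cases h with
  | node r _ _ h =>
    cases h <;> simp [State.send, hold] at hmem
    · obtain ⟨rfl, rfl, rfl⟩ := hmem
      exact ⟨‹_›, Or.inl ⟨_, _, _, ‹_›, ‹_›⟩⟩
    · obtain ⟨rfl, rfl, rfl⟩ := hmem
      exact ⟨‹_›, Or.inr ⟨‹_›, ‹_›, _, ‹_›, _, ‹_›, ‹_›⟩⟩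
  | _ => exact absurd hmem hold

/-! ### Invariants of reachable states -/

/-- Only `combine` creates threshold signatures, and shares, once sent, stay in `net`. -/
theorem Reachable.localMajority_of_threshold (h : Reachable faulty σ) {P : C.Cluster}
    {b : Body C} (hmem : Msg.threshold P b ∈ σ.net) :
    LocalMajority P (fun q => Msg.share q b ∈ σ.net) := by
  induction h with
  | refl => exact absurd hmem (Set.notMem_empty _)
  | tail _ hstep ih =>
    exact ((hstep.threshold_new hmem).elim ih id).mono fun _ hr => hstep.net_subset hr

/-- A node that is not malicious signs only orders of known requests that its cluster has
decided. -/
theorem Reachable.decided_of_ordered (h : Reachable faulty σ) {q : C.Node}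
    (hq : ¬ Malicious faulty q) {id : TxID C} {d : C.Digest} (ho : Ordered σ q id d) :
    ∃ m, C.digest m = d ∧ Known σ m ∧ (q, Decision.order id m) ∈ σ.decided := by
  induction h with
  | refl => simp [Ordered, State.init] at ho
  | tail _ hstep ih =>
    obtain ⟨m, hd, hk, hdec⟩ := (hstep.ordered_new hq ho).elim ih And.left
    exact ⟨m, hd, hk.mono hstep.net_subset, hstep.decided_subset hdec⟩

theorem Reachable.prepared_of_share_commit (h : Reachable faulty σ) {q : C.Node}
    (hq : ¬ Malicious faulty q) {ids : IDVec C} {d : C.Digest}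
    (hmem : Msg.share q (.commit ids d) ∈ σ.net) :
    ∃ m s₀ e₀ idc, C.digest m = d ∧ InvolvedAt m (C.clusterOf q) s₀ e₀ ∧
      Msg.threshold (C.clusterOf q) (.prepare idc d m) ∈ σ.net ∧
      PreparedByAll σ m d s₀ e₀ idc ids := by
  induction h with
  | refl => exact absurd hmem (Set.notMem_empty _)
  | tail _ hstep ih =>
    obtain ⟨m, s₀, e₀, idc, hd, hc, hth, hp⟩ := (hstep.share_commit_new hq hmem).elim ih id
    exact ⟨m, s₀, e₀, idc, hd, hc, hstep.net_subset hth, hp.mono hstep.net_subset⟩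

theorem Reachable.certified_of_committed (h : Reachable faulty σ) {q : C.Node} {m : C.Request}
    {ids : IDVec C} (hmem : (q, m, ids) ∈ σ.committed) :
    Known σ m ∧ CommitCertified σ q m ids := by
  induction h with
  | refl => exact absurd hmem (Set.notMem_empty _)
  | tail _ hstep ih =>
    obtain ⟨hk, hc⟩ := (hstep.committed_new hmem).elim ih id
    exact ⟨hk.mono hstep.net_subset, hc.mono hstep.net_subset⟩

/-- A node that is not malicious validates only orders that are compatible with all the other
orders it agrees with, earlier or later. -/
theorem Reachable.compatible_of_validated (h : Reachable faulty σ) {q : C.Node}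
    (hq : ¬ Malicious faulty q) {id id' : TxID C} {d d' : C.Digest}
    (hv : Validated σ q id d) (ho : Validated σ q id' d' ∨ Ordered σ q id' d') :
    Compatible id d id' d' := by
  induction h with
  | refl => simp [Validated, State.init] at hv
  | tail _ hstep ih =>
    -- Whichever of the two agreements came later was checked against the earlier one.
    rcases hstep.validated_new hq hv with hv₁ | ⟨hc, idc, hσ⟩
    · rcases ho with hv' | ho
      · rcases hstep.validated_new hq hv' with hv₂ | ⟨hc', -⟩
        · exact ih hv₁ (Or.inl hv₂)
        · exact hc' _ _ (Or.inl hv₁)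
      · rcases hstep.ordered_new hq ho with ho₁ | ⟨-, hc', -⟩
        · exact ih hv₁ (Or.inr ho₁)
        · exact hc' _ _ hv₁
    · subst hσ
      rcases ho with ⟨idc', hv'⟩ | ho
      · rcases Set.mem_insert_iff.1 hv' with heq | hmem
        · simp only [Msg.signed.injEq, Body.prepared.injEq] at heq
          -- Both are the same new message, so the digests agree and compatibility is vacuous.
          exact fun _ hd => absurd heq.2.2.2.symm hd
        · exact (hc _ _ (Or.inl ⟨idc', hmem⟩)).symm
      · refine (hc _ _ (Or.inr ?_)).symm
        -- Sending a `signed` message adds no share, so the order was signed before this step.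
        simpa [Ordered, State.send] using ho

/-! ### Agreement -/

theorem InvolvedAt.owner_eq {m : C.Request} {P : C.Cluster} {s : C.Shard} {e : C.Enterprise}
    (h : InvolvedAt m P s e) : C.owner P = e := by
  obtain ⟨hs, he, rfl⟩ := h
  exact C.owner_place _ _ (C.shards_subset m hs) _ he

/-- The shard that a cluster maintains for a request is determined by the cluster. -/
theorem InvolvedAt.unique {m : C.Request} {P : C.Cluster} {s s' : C.Shard}
    {e e' : C.Enterprise} (h : InvolvedAt m P s e) (h' : InvolvedAt m P s' e') :
    s = s' ∧ e = e' := by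
  -- The owner of the cluster fixes the enterprise; injectivity of the placement then fixes the
  -- shard.
  obtain rfl : e = e' := h.owner_eq.symm.trans h'.owner_eq
  refine ⟨?_, rfl⟩
  exact C.place_injOn _ e h.2.1 (C.shards_subset m h.1) (C.shards_subset m h'.1)
    (h.2.2.symm.trans h'.2.2)

/-- A committed request has been ordered, or validated, by a local-majority of each involved
cluster. -/
theorem Commits.known_and_localMajority (hfault : FaultBound faulty) (hreach : Reachable faulty σ)
    (hcoll : NoCollision σ) {r : C.Node} {m : C.Request} {α : LocalID C} {P : C.Cluster}
    (h : Commits σ r m α P) :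
    Known σ m ∧ ∃ id : TxID C, id.loc = α ∧
      (LocalMajority P (fun q => Ordered σ q id (C.digest m)) ∨
        LocalMajority P (fun q => Validated σ q id (C.digest m))) := by
  obtain ⟨ids, s, e, id, hmem, hinv, hid, hα⟩ := h
  obtain ⟨hk, hcert⟩ := hreach.certified_of_committed hmem
  refine ⟨hk, id, hα, ?_⟩
  rcases hcert with ⟨Pc, s₀, e₀, hc, hth⟩ | ⟨hintra, ⟨s₁, e₁, hv⟩, s₂, hs₂, id₂, hid₂, hth⟩
  · obtain ⟨q, hq, hqm, hsh⟩ := exists_not_malicious_of_localMajority hfault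
      (hreach.localMajority_of_threshold hth)
    obtain ⟨m₁, s₁, e₁, idc, hd, hc₁, hprep, hall⟩ := hreach.prepared_of_share_commit hqm hsh
    -- The COMMIT message names only a digest; the PREPARE message behind it exhibits `m₁`, which
    -- must then be `m`.
    have hk₁ : Known σ m₁ := Or.inr ⟨idc, _, Or.inr (Or.inr ⟨_, hprep⟩)⟩
    obtain rfl := hcoll m₁ m hk₁ hk hd
    rw [C.clusterOf_ordering Pc q hq] at hc₁ hprep
    -- The committing node and the signer mean the same coordinator shard and enterprise.
    obtain ⟨rfl, rfl⟩ := hc.unique hc₁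
    obtain ⟨id', hid', hin, hout⟩ := hall.2 s hinv.1
    obtain rfl : id = id' := Option.some.inj (hid.symm.trans hid')
    obtain ⟨-, he, rfl⟩ := hinv
    -- Clusters of the initiator enterprise signed the order: in PREPARE on the coordinator's shard,
    -- in PREPARED on the others. Clusters of other enterprises validated it.
    by_cases hee : e = e₀
    · subst hee
      refine Or.inl ?_
      by_cases hss : s = s₀
      · subst hss
        obtain rfl : id = idc := Option.some.inj (hid.symm.trans hall.1)
        rw [← hc.2.2]
        exact (hreach.localMajority_of_threshold hprep).mono fun _ h => Or.inl ⟨_, h⟩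
      · exact (hreach.localMajority_of_threshold (hin hss)).mono
          fun _ h => Or.inr (Or.inl ⟨_, h⟩)
    · exact Or.inr ((hout e he hee).mono fun _ h => ⟨_, h⟩)
  · refine Or.inl ?_
    -- With one shard and one enterprise there is a single involved cluster, so `P` is the cluster
    -- of the committing node and all the shards in play coincide.
    obtain ⟨t, ht⟩ := Finset.card_eq_one.1 hintra.1
    obtain ⟨x, hx⟩ := Finset.card_eq_one.1 hintra.2
    obtain ⟨hs, he, rfl⟩ := hinv
    obtain ⟨hs₁, he₁, hP⟩ := hv
    have hss₁ : s = s₁ := by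
      rw [ht, Finset.mem_singleton] at hs hs₁; exact hs.trans hs₁.symm
    have hss₂ : s = s₂ := by
      rw [ht, Finset.mem_singleton] at hs hs₂; exact hs.trans hs₂.symm
    have hee₁ : e = e₁ := by
      rw [hx, Finset.mem_singleton] at he he₁; exact he.trans he₁.symm
    subst hss₁ hss₂ hee₁
    obtain rfl : id = id₂ := Option.some.inj (hid.symm.trans hid₂)
    rw [← hP]
    exact (hreach.localMajority_of_threshold hth).mono fun _ h => Or.inr (Or.inr h)

/-- An order that a local-majority of a cluster has signed is decided at a node of the cluster
that is not malicious. -/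
theorem Reachable.exists_decided_of_localMajority (hreach : Reachable faulty σ)
    (hfault : FaultBound faulty) (hcoll : NoCollision σ) {P : C.Cluster} {id : TxID C}
    {m : C.Request} (hk : Known σ m)
    (h : LocalMajority P (fun q => Ordered σ q id (C.digest m))) :
    ∃ q, C.clusterOf q = P ∧ ¬ Malicious faulty q ∧ (q, Decision.order id m) ∈ σ.decided := by
  obtain ⟨q, hq, hqm, ho⟩ := exists_not_malicious_of_localMajority hfault h
  obtain ⟨m₁, hd, hk₁, hdec⟩ := hreach.decided_of_ordered hqm ho
  obtain rfl := hcoll m₁ m hk₁ hk hd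
  exact ⟨q, C.clusterOf_ordering P q hq, hqm, hdec⟩

theorem Commits.request_unique (hfault : FaultBound faulty) (hreach : Reachable faulty σ)
    (hcoll : NoCollision σ) (hint : InternalConsensusSafe faulty σ) {r r' : C.Node}
    {m m' : C.Request} {α : LocalID C} {P : C.Cluster} (h : Commits σ r m α P)
    (h' : Commits σ r' m' α P) : m = m' := by
  obtain ⟨hk, id, hα, hmaj⟩ := h.known_and_localMajority hfault hreach hcoll
  obtain ⟨hk', id', hα', hmaj'⟩ := h'.known_and_localMajority hfault hreach hcoll
  have hloc : id.loc = id'.loc := hα.trans hα'.symm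
  by_contra hne
  have hd : C.digest m ≠ C.digest m' := fun hd => hne (hcoll m m' hk hk' hd)
  rcases hmaj with ho | hv
  · rcases hmaj' with ho' | hv'
    · obtain ⟨q, hqP, hq, hdec⟩ := hreach.exists_decided_of_localMajority hfault hcoll hk ho
      obtain ⟨q', hqP', hq', hdec'⟩ := hreach.exists_decided_of_localMajority hfault hcoll hk' ho'
      have heq := hint q q' _ _ (hqP.trans hqP'.symm) hq hq' hdec hdec'
        -- The instance depends only on the local part, so `id` and `id'` may a priori differ in
        -- their global parts.
        (by simp only [Decision.inst, hloc])
      exact hne (Decision.order.inj heq).2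
    · obtain ⟨q, hq, ho, hv'⟩ := exists_not_malicious_of_two_localMajorities hfault ho hv'
      exact not_compatible_of_loc_eq hloc.symm hd.symm
        (hreach.compatible_of_validated hq hv' (Or.inr ho))
  -- With `m` validated, it does not matter how the votes for `m'` were cast.
  · have hor : LocalMajority P
        (fun q => Validated σ q id' (C.digest m') ∨ Ordered σ q id' (C.digest m')) :=
      hmaj'.elim (fun h => h.mono fun _ => Or.inr) (fun h => h.mono fun _ => Or.inl)
    obtain ⟨q, hq, hv, ho⟩ := exists_not_malicious_of_two_localMajorities hfault hv hor
    exact not_compatible_of_loc_eq hloc hd (hreach.compatible_of_validated hq hv ho)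

end Qanaat

theorem mainTheorem1 (C : Qanaat.System) (faulty : Set C.Node)
    (hfault : Qanaat.FaultBound faulty) (σ : Qanaat.State C)
    (hreach : Qanaat.Reachable faulty σ) (hcoll : Qanaat.NoCollision σ)
    (hint : Qanaat.InternalConsensusSafe faulty σ)
    (P : C.Cluster) (α : Qanaat.LocalID C) (r : C.Node) (m : C.Request)
    (hcommit : Qanaat.Commits σ r m α P)
    (r' : C.Node) (hr' : r' ∉ faulty) (m' : C.Request) (hne : m ≠ m') :
    ¬ Qanaat.Commits σ r' m' α P := by
  exact fun hcommit' => hne (hcommit.request_unique hfault hreach hcoll hint hcommit')
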